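/- Let $X$ be a real Banach space with a Schauder basis $(e_i)_{i\ge 1}$ that is pre-monotone, i.e. with coefficient functionals $(e_i^*)$, $$\Big\| x-\sum_{i=1}^n e_i^*(x)e_i\Big\|\le \|x\|\qquad\text{for all } x\in X,\ n\in\mathbb N.$$ If $X$ contains an isomorphic copy of $\mathrm{c}_0$ (the space of real sequences tending to zero, under the supremum norm), then $X$ fails the fixed point property for affine nonexpansive mappings; that is, there exist a nonempty closed bounded convex set $C\subset X$ and a mapping $T\colon C\to C$ such that $\|Tx-Ty\|\le\|x-y\|$ and $T(\lambda x+(1-\lambda)y)=\lambda Tx+(1-\lambda)Ty$ for all $x,y\in C$ and $\lambda\in[0,1]$, while $T$ has no fixed point in $C$. -/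

import Mathlib

open scoped ZeroAtInfty

/-- The basis `(eᵢ)` is pre-monotone: every tail projection `Rₙ = I - Pₙ` satisfies
`‖Rₙ x‖ ≤ ‖x‖`. Here `b.proj n x = ∑ i ∈ range n, eᵢ*(x) eᵢ`. -/
def SchauderBasis.IsPremonotone {X : Type*} [NormedAddCommGroup X] [NormedSpace ℝ X]
    (b : SchauderBasis ℝ X) : Prop :=
  ∀ (n : ℕ) (x : X), ‖x - SchauderBasis.proj b n x‖ ≤ ‖x‖

/-- `X` contains an isomorphic copy of `c₀`: some linear subspace of `X` is linearly homeomorphic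
to `c₀`. The space `C₀(ℕ, ℝ)`, with `ℕ` discrete, is the space of real sequences tending to zero
with the supremum norm. -/
def ContainsCopyOfCZero (X : Type*) [NormedAddCommGroup X] [NormedSpace ℝ X] : Prop :=
  ∃ Y : Submodule ℝ X, Nonempty (C₀(ℕ, ℝ) ≃L[ℝ] Y)

/-- `T` respects convex combinations of points of `C`. -/
def IsAffineMapOn {X : Type*} [NormedAddCommGroup X] [NormedSpace ℝ X]
    (C : Set X) (T : X → X) : Prop :=
  ∀ x ∈ C, ∀ y ∈ C, ∀ t ∈ Set.Icc (0 : ℝ) 1,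
    T (t • x + (1 - t) • y) = t • T x + (1 - t) • T y

/-- The set `C` has the fixed point property for affine nonexpansive mappings `T : C → C`.
(Only the values of `T` on `C` matter.) -/
def SetHasAffineFPP {X : Type*} [NormedAddCommGroup X] [NormedSpace ℝ X] (C : Set X) : Prop :=
  ∀ T : X → X, Set.MapsTo T C C → LipschitzOnWith 1 T C → IsAffineMapOn C T → ∃ x ∈ C, T x = x

/-- The space `X` has the fixed point property for affine nonexpansive mappings. -/
def HasAffineFPP (X : Type*) [NormedAddCommGroup X] [NormedSpace ℝ X] : Prop :=
  ∀ C : Set X, C.Nonempty → IsClosed C → Bornology.IsBounded C → Convex ℝ C → SetHasAffineFPP C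

open Filter Topology

/-! A space containing `c₀` has no boundedly complete basis: a gliding hump through the images of
the unit vectors gives a formal series `∑ wᵢ eᵢ` with bounded partial sums `W k` and no limit
(`exists_bounded_partialSum_of_containsCopyOfCZero`). Pre-monotonicity makes each affine map `x ↦ x
- P k x + W k` nonexpansive, and so is their average with weights `2⁻ᵏ⁻¹`. A fixed point of the
average would have coordinates `w`, which no vector has (`not_hasAffineFPP_of_partialSum`). -/

theorem hasSum_half_pow_succ : HasSum (fun k : ℕ => (1 / 2 : ℝ) ^ (k + 1)) 1 := by
  simpa [pow_succ, div_mul_eq_mul_div] using hasSum_geometric_two.mul_right (1 / 2 : ℝ)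

section

variable {X : Type*} [NormedAddCommGroup X] [NormedSpace ℝ X]

theorem norm_le_of_hasSum_half_pow_smul {u : ℕ → X} {s : X} {M : ℝ}
    (h : HasSum (fun k => (1 / 2 : ℝ) ^ (k + 1) • u k) s) (hu : ∀ k, ‖u k‖ ≤ M) : ‖s‖ ≤ M := by
  have hM : HasSum (fun k : ℕ => (1 / 2 : ℝ) ^ (k + 1) * M) M := by
    simpa using hasSum_half_pow_succ.mul_right M
  refine h.norm_le_of_bounded hM fun k => ?_
  rw [norm_smul, Real.norm_of_nonneg (by positivity)]
  exact mul_le_mul_of_nonneg_left (hu k) (by positivity)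

theorem summable_half_pow_smul [CompleteSpace X] {u : ℕ → X} {M : ℝ} (hu : ∀ k, ‖u k‖ ≤ M) :
    Summable (fun k => (1 / 2 : ℝ) ^ (k + 1) • u k) := by
  refine Summable.of_norm_bounded (hasSum_half_pow_succ.summable.mul_right M) fun k => ?_
  rw [norm_smul, Real.norm_of_nonneg (by positivity)]
  exact mul_le_mul_of_nonneg_left (hu k) (by positivity)

theorem hasSum_half_pow_smul_const (v : X) :
    HasSum (fun k : ℕ => (1 / 2 : ℝ) ^ (k + 1) • v) v := by
  simpa using hasSum_half_pow_succ.smul_const v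

end

/-! ### The averaged map and its invariant set -/

namespace SchauderBasis

variable {X : Type*} [NormedAddCommGroup X] [NormedSpace ℝ X] (b : SchauderBasis ℝ X)

/-- The `n`-th partial sum of the formal series `∑ wᵢ eᵢ`. -/
noncomputable def partialSum (w : ℕ → ℝ) (n : ℕ) : X := ∑ i ∈ Finset.range n, w i • b i

theorem coord_partialSum (w : ℕ → ℝ) (n i : ℕ) :
    b.coord i (b.partialSum w n) = if i < n then w i else 0 := by
  simp [partialSum, b.ortho, Pi.single_apply]

theorem coord_proj (n i : ℕ) (x : X) :
    b.coord i (SchauderBasis.proj b n x) = if i < n then b.coord i x else 0 := by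
  simp [b.ortho, Pi.single_apply]

theorem proj_partialSum (w : ℕ → ℝ) (n k : ℕ) :
    SchauderBasis.proj b n (b.partialSum w k) = b.partialSum w (min n k) := by
  rw [proj_apply]
  simp only [coord_partialSum, ite_smul, zero_smul]
  rw [← Finset.sum_filter, partialSum]
  refine Finset.sum_congr ?_ fun _ _ => rfl
  ext i
  simp

/-- If some formal series `∑ wᵢ eᵢ` has bounded partial sums but represents no vector, then a space
with a pre-monotone basis fails the fixed point property for affine nonexpansive maps. The map is
the average of the maps replacing the first `k` coordinates of `x` by those of `w`. -/
theorem IsPremonotone.not_hasAffineFPP_of_partialSum [CompleteSpace X] {b : SchauderBasis ℝ X}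
    (hb : b.IsPremonotone) {w : ℕ → ℝ} {B : ℝ} (hB : ∀ n, ‖b.partialSum w n‖ ≤ B)
    (hw : ¬ ∃ x, ∀ i, b.coord i x = w i) : ¬ HasAffineFPP X := by
  intro H
  set P := SchauderBasis.proj b with hP
  set W := b.partialSum w with hW
  have hB0 : 0 ≤ B := (norm_nonneg _).trans (hB 0)
  set M : ℝ := 2 * B with hM
  have hM0 : 0 ≤ M := by positivity
  -- All blocks `[m, n)` are controlled, not just initial ones: `A k` turns an initial block of `x -
  -- w` into a block starting at `k`. The value `M = 2 * B` puts `0` in `C`.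
  set C : Set X := {x | ∀ m n, m ≤ n → ‖(P n - P m) x - (W n - W m)‖ ≤ M} with hC
  set A : ℕ → X → X := fun k x => x - P k x + W k with hA
  set T : X → X := fun x => ∑' k : ℕ, (1 / 2 : ℝ) ^ (k + 1) • A k x with hT
  have hCP : ∀ x ∈ C, ∀ k, ‖P k x - W k‖ ≤ M := fun x hx k => by
    simpa [P, W, partialSum, -proj_apply] using hx 0 k k.zero_le
  have hsum : ∀ x ∈ C, HasSum (fun k : ℕ => (1 / 2 : ℝ) ^ (k + 1) • A k x) (T x) := by
    intro x hx
    refine (summable_half_pow_smul (M := ‖x‖ + M) fun k => ?_).hasSum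
    have : A k x = x - (P k x - W k) := by simp only [hA]; abel
    rw [this]
    exact (norm_sub_le _ _).trans (add_le_add le_rfl (hCP x hx k))
  have hPP : ∀ n k x, P n (P k x) = P (min n k) x := fun n k x => b.proj_comp n k x
  have hPW : ∀ n k, P n (W k) = W (min n k) := fun n k => b.proj_partialSum w n k
  have hAC : ∀ x ∈ C, ∀ k, A k x ∈ C := by
    intro x hx k m n hmn
    have e : (P n - P m) (A k x) - (W n - W m) =
        P n x - P (min n k) x + W (min n k) - (P m x - P (min m k) x + W (min m k))
          - (W n - W m) := by
      simp only [hA, sub_apply, map_add, map_sub, hPP, hPW]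
      abel
    rw [e]
    -- The coordinates of `A k x - w` vanish below `k` and agree with those of `x - w` from `k` on,
    -- so its block over `[m, n)` is a block of `x - w` or zero.
    rcases le_total k m with hkm | hmk
    · rw [min_eq_right hkm, min_eq_right (hkm.trans hmn)]
      convert hx m n hmn using 2
      rw [sub_apply]
      abel
    rcases le_total k n with hkn | hnk
    · rw [min_eq_right hkn, min_eq_left hmk]
      convert hx k n hkn using 2
      rw [sub_apply]
      abel
    · rw [min_eq_left hnk, min_eq_left hmk]
      convert hM0
      rw [norm_eq_zero]
      abel
  have hmaps : Set.MapsTo T C C := by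
    intro x hx m n hmn
    have h1 := ((hsum x hx).mapL (P n - P m)).sub (hasSum_half_pow_smul_const (W n - W m))
    simp only [map_smul, ← smul_sub] at h1
    exact norm_le_of_hasSum_half_pow_smul h1 fun k => hAC x hx k m n hmn
  have hlip : LipschitzOnWith 1 T C := by
    refine LipschitzOnWith.of_dist_le_mul fun x hx y hy => ?_
    have h1 := (hsum x hx).sub (hsum y hy)
    simp only [← smul_sub] at h1
    rw [dist_eq_norm, dist_eq_norm, NNReal.coe_one, one_mul]
    refine norm_le_of_hasSum_half_pow_smul h1 fun k => ?_
    convert hb k (x - y) using 2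
    simp only [hA, map_sub, ← hP]
    abel
  have hconv : Convex ℝ C := by
    intro x hx y hy s t hs ht hst m n hmn
    have e : (P n - P m) (s • x + t • y) - (W n - W m) =
        s • ((P n - P m) x - (W n - W m)) + t • ((P n - P m) y - (W n - W m)) := by
      obtain rfl : t = 1 - s := by linarith
      rw [map_add, map_smul, map_smul]
      module
    rw [e]
    calc _ ≤ s * M + t * M := by
          refine (norm_add_le _ _).trans (add_le_add ?_ ?_)
          · rw [norm_smul, Real.norm_of_nonneg hs]
            exact mul_le_mul_of_nonneg_left (hx m n hmn) hs
          · rw [norm_smul, Real.norm_of_nonneg ht]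
            exact mul_le_mul_of_nonneg_left (hy m n hmn) ht
      _ = M := by rw [← add_mul, hst, one_mul]
  have haff : IsAffineMapOn C T := by
    intro x hx y hy t ht
    have hz := hconv hx hy ht.1 (sub_nonneg.2 ht.2) (by ring)
    refine (hsum _ hz).unique ?_
    convert ((hsum x hx).const_smul t).add ((hsum y hy).const_smul (1 - t)) using 1
    funext k
    simp only [hA, map_add, map_smul]
    module
  have hne : C.Nonempty := by
    refine ⟨0, fun m n _ => ?_⟩
    rw [map_zero, zero_sub, norm_neg, hM, two_mul]
    exact (norm_sub_le _ _).trans (add_le_add (hB n) (hB m))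
  have hclosed : IsClosed C := by
    simp only [hC, Set.ofPred_forall]
    refine isClosed_iInter fun m => isClosed_iInter fun n => isClosed_iInter fun _ => ?_
    exact isClosed_le (by fun_prop) continuous_const
  have hbdd : Bornology.IsBounded C := by
    refine isBounded_iff_forall_norm_le.2 ⟨M + B, fun x hx => ?_⟩
    refine le_of_tendsto (b.tendsto_proj x).norm (Eventually.of_forall fun n => ?_)
    calc _ = ‖(P n x - W n) + W n‖ := by rw [sub_add_cancel]
      _ ≤ M + B := (norm_add_le _ _).trans (add_le_add (hCP x hx n) (hB n))
  obtain ⟨x, hx, hfix⟩ := H C hne hclosed hbdd hconv T hmaps hlip haff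
  refine hw ⟨x, fun i => ?_⟩
  set c := b.coord i x - w i with hc
  -- The factor `-c` turns the `i`-th coordinate of `T x - x` into a series of nonnegative terms;
  -- its sum is zero, so each term is.
  have h1 := (((hsum x hx).sub (hasSum_half_pow_smul_const x)).mapL (b.coord i)).mul_right (-c)
  have h2 : HasSum (fun k : ℕ => (1 / 2 : ℝ) ^ (k + 1) * if i < k then c * c else 0) 0 := by
    rw [hfix, sub_self, map_zero, zero_mul] at h1
    refine Eq.subst (motive := fun f => HasSum f 0) (funext fun k => ?_) h1
    simp only [hA, ← smul_sub, map_smul, map_sub, map_add, hP, hW, coord_proj, coord_partialSum,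
      smul_eq_mul]
    split_ifs
    · rw [hc]; ring
    · ring
  have h3 := (hasSum_zero_iff_of_nonneg fun k => by
    have := mul_self_nonneg c
    positivity).1 h2
  have h4 := congrFun h3 (i + 1)
  simp only [Nat.lt_succ_self, if_true, Pi.zero_apply, mul_eq_zero, or_self] at h4
  rcases h4 with h4 | h4
  · exact absurd h4 (by positivity)
  · exact sub_eq_zero.1 h4

end SchauderBasis

/-! ### Unit vectors of `c₀` and their images -/

/-- The nonnegative and the negative terms of a finite sum each contribute at most `K`. -/
theorem summable_abs_of_abs_sum_le {a : ℕ → ℝ} {K : ℝ}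
    (h : ∀ s : Finset ℕ, |∑ n ∈ s, a n| ≤ K) : Summable fun n => |a n| := by
  refine summable_of_sum_le (c := K + K) (fun _ => abs_nonneg _) fun s => ?_
  rw [← Finset.sum_filter_add_sum_filter_not s (fun n => 0 ≤ a n)]
  refine add_le_add ?_ ?_
  · rw [Finset.sum_congr rfl fun n hn => abs_of_nonneg (Finset.mem_filter.1 hn).2]
    exact (le_abs_self _).trans (h _)
  · rw [Finset.sum_congr rfl fun n hn => abs_of_neg (not_le.1 (Finset.mem_filter.1 hn).2),
      Finset.sum_neg_distrib]
    exact (neg_le_abs _).trans (h _)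

section

open scoped ZeroAtInfty

/-- The `n`-th unit vector of `c₀`. -/
noncomputable def czeroUnit (n : ℕ) : C₀(ℕ, ℝ) where
  toFun := Pi.single n 1
  continuous_toFun := continuous_of_discreteTopology
  zero_at_infty' := by
    rw [cocompact_eq_cofinite]
    refine tendsto_const_nhds.congr' ?_
    filter_upwards [(Set.finite_singleton n).compl_mem_cofinite] with i hi
    simp [Pi.single_eq_of_ne (Set.mem_compl_singleton_iff.1 hi)]

theorem czeroUnit_apply (n i : ℕ) : czeroUnit n i = if i = n then 1 else 0 := by
  change (Pi.single n 1 : ℕ → ℝ) i = _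
  rw [Pi.single_apply]

theorem sum_czeroUnit_apply (s : Finset ℕ) (i : ℕ) :
    (∑ n ∈ s, czeroUnit n) i = if i ∈ s then 1 else 0 := by
  induction s using Finset.induction_on with
  | empty => simp
  | insert n s hn ih =>
    rw [Finset.sum_insert hn, ZeroAtInftyContinuousMap.add_apply, ih, czeroUnit_apply]
    by_cases h : i = n
    · subst h; simp [hn]
    · simp [h]

theorem norm_sum_czeroUnit_le (s : Finset ℕ) : ‖∑ n ∈ s, czeroUnit n‖ ≤ 1 := by
  rw [← ZeroAtInftyContinuousMap.norm_toBCF_eq_norm,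
    BoundedContinuousFunction.norm_le zero_le_one]
  intro i
  change ‖(∑ n ∈ s, czeroUnit n) i‖ ≤ 1
  rw [sum_czeroUnit_apply]
  split_ifs <;> simp

theorem one_le_norm_czeroUnit (n : ℕ) : 1 ≤ ‖czeroUnit n‖ := by
  rw [← ZeroAtInftyContinuousMap.norm_toBCF_eq_norm]
  refine le_trans ?_ ((czeroUnit n).toBCF.norm_coe_le_norm n)
  change 1 ≤ ‖czeroUnit n n‖
  simp [czeroUnit_apply]

end

theorem ContainsCopyOfCZero.exists_seq {X : Type*} [NormedAddCommGroup X] [NormedSpace ℝ X]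
    (h : ContainsCopyOfCZero X) :
    ∃ (y : ℕ → X) (c B : ℝ), 0 < c ∧ (∀ n, c ≤ ‖y n‖) ∧ ∀ s : Finset ℕ, ‖∑ n ∈ s, y n‖ ≤ B := by
  obtain ⟨Y, ⟨e⟩⟩ := h
  set S : Y →L[ℝ] _ := e.symm.toContinuousLinearMap with hS
  -- The added `1` allows division without checking `‖S‖ ≠ 0`.
  have hlow : ∀ n, 1 ≤ (‖S‖ + 1) * ‖e (czeroUnit n)‖ := fun n => by
    have h1 : ‖czeroUnit n‖ ≤ ‖S‖ * ‖e (czeroUnit n)‖ := by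
      simpa [hS] using S.le_opNorm (e (czeroUnit n))
    nlinarith [one_le_norm_czeroUnit n, norm_nonneg (e (czeroUnit n))]
  have hS0 : 0 < ‖S‖ + 1 := by positivity
  refine ⟨fun n => e (czeroUnit n), (‖S‖ + 1)⁻¹, ‖e.toContinuousLinearMap‖, by positivity,
    fun n => ?_, fun s => ?_⟩
  · rw [inv_le_iff_one_le_mul₀' hS0]
    exact hlow n
  · have h1 := e.toContinuousLinearMap.le_opNorm (∑ n ∈ s, czeroUnit n)
    have h2 : ∑ n ∈ s, (e (czeroUnit n) : X) = (e (∑ n ∈ s, czeroUnit n) : Y) := by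
      rw [map_sum, Submodule.coe_sum]
    rw [h2]
    refine h1.trans ?_
    exact mul_le_of_le_one_right (norm_nonneg _) (norm_sum_czeroUnit_le s)

/-! ### Gliding hump -/

namespace SchauderBasis

variable {X : Type*} [NormedAddCommGroup X] [NormedSpace ℝ X] (b : SchauderBasis ℝ X)

/-- Every functional makes `∑ y n` absolutely summable, so each of the finitely many coordinates
involved tends to zero. -/
theorem tendsto_proj_of_norm_sum_le {y : ℕ → X} {B : ℝ}
    (hy : ∀ s : Finset ℕ, ‖∑ n ∈ s, y n‖ ≤ B) (q : ℕ) :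
    Tendsto (fun n => SchauderBasis.proj b q (y n)) atTop (𝓝 0) := by
  have hcoord : ∀ i, Tendsto (fun n => b.coord i (y n)) atTop (𝓝 0) := fun i => by
    refine (tendsto_zero_iff_abs_tendsto_zero _).2
      (summable_abs_of_abs_sum_le (K := ‖b.coord i‖ * B) fun s => ?_).tendsto_atTop_zero
    rw [← map_sum, ← Real.norm_eq_abs]
    exact (b.coord i).le_opNorm_of_le (hy s)
  simp only [proj_apply]
  rw [show (0 : X) = ∑ i ∈ Finset.range q, (0 : ℝ) • b i by simp]
  exact tendsto_finsetSum _ fun i _ => (hcoord i).smul_const _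

/-- Gliding hump: a subsequence of `y` lies close to blocks of the basis. -/
theorem exists_subseq_near_blocks {y : ℕ → X} {B : ℝ}
    (hy : ∀ s : Finset ℕ, ‖∑ n ∈ s, y n‖ ≤ B) {ε : ℕ → ℝ} (hε : ∀ k, 0 < ε k) :
    ∃ φ q : ℕ → ℕ, StrictMono φ ∧ StrictMono q ∧ ∀ k,
      ‖SchauderBasis.proj b (q (k + 1)) (y (φ k)) - SchauderBasis.proj b (q k) (y (φ k)) - y (φ k)‖
        ≤ ε k := by
  have step : ∀ k (p : ℕ × ℕ), ∃ p' : ℕ × ℕ, p.1 < p'.1 ∧ p.2 < p'.2 ∧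
      ‖SchauderBasis.proj b p'.2 (y p'.1) - SchauderBasis.proj b p.2 (y p'.1) - y p'.1‖ ≤ ε k := by
    intro k p
    have hε2 : 0 < ε k / 2 := half_pos (hε k)
    obtain ⟨n, hn, hpn⟩ := ((Metric.tendsto_nhds.1 (b.tendsto_proj_of_norm_sum_le hy p.2) _
      hε2).and (eventually_gt_atTop p.1)).exists
    obtain ⟨q, hq, hpq⟩ := ((Metric.tendsto_nhds.1 (b.tendsto_proj (y n)) _
      hε2).and (eventually_gt_atTop p.2)).exists
    refine ⟨(n, q), hpn, hpq, ?_⟩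
    rw [dist_zero_right] at hn
    rw [dist_eq_norm] at hq
    have h := norm_sub_le (SchauderBasis.proj b q (y n) - y n) (SchauderBasis.proj b p.2 (y n))
    rw [sub_right_comm]
    linarith
  choose f hf1 hf2 hf3 using step
  set p : ℕ → ℕ × ℕ := fun k => Nat.rec (0, 0) f k with hp
  exact ⟨fun k => (p (k + 1)).1, fun k => (p k).2,
    strictMono_nat_of_lt_succ fun k => hf1 (k + 1) (p (k + 1)),
    strictMono_nat_of_lt_succ fun k => hf2 k (p k), fun k => hf3 k (p k)⟩

/-- A Schauder basis of a space containing `c₀` is not boundedly complete. -/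
theorem exists_bounded_partialSum_of_containsCopyOfCZero [CompleteSpace X]
    (hX : ContainsCopyOfCZero X) :
    ∃ (w : ℕ → ℝ) (B : ℝ), (∀ n, ‖b.partialSum w n‖ ≤ B) ∧ ¬ ∃ x, ∀ i, b.coord i x = w i := by
  obtain ⟨y, c, B, hc, hyc, hyB⟩ := hX.exists_seq
  obtain ⟨D, hD⟩ := b.exists_norm_proj_le
  -- The errors sum to `c / 2`: each block keeps norm at least `c / 2`, and sums of blocks stay
  -- bounded.
  obtain ⟨φ, q, hφ, hq, hφq⟩ := b.exists_subseq_near_blocks hyB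
    (ε := fun k => (1 / 2 : ℝ) ^ (k + 1) * (c / 2)) fun k => by positivity
  set P := SchauderBasis.proj b with hP
  set z : ℕ → X := fun k => P (q (k + 1)) (y (φ k)) - P (q k) (y (φ k)) with hz
  have hznorm : ∀ k, c / 2 ≤ ‖z k‖ := fun k => by
    have h1 : (1 / 2 : ℝ) ^ (k + 1) ≤ 1 := pow_le_one₀ (by norm_num) (by norm_num)
    have h2 := norm_sub_norm_le (y (φ k)) (z k)
    rw [norm_sub_rev (y (φ k)) (z k)] at h2
    nlinarith [hφq k, hyc (φ k)]
  have hzsum : ∀ K, ‖∑ k ∈ Finset.range K, z k‖ ≤ c / 2 + B := fun K => by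
    have e : ∑ k ∈ Finset.range K, z k =
        ∑ k ∈ Finset.range K, (z k - y (φ k)) + ∑ k ∈ Finset.range K, y (φ k) := by
      rw [← Finset.sum_add_distrib]; simp
    rw [e]
    refine (norm_add_le _ _).trans (add_le_add ?_ ?_)
    · refine (norm_sum_le_of_le _ fun k _ => hφq k).trans ?_
      rw [← Finset.sum_mul]
      exact mul_le_of_le_one_left (by positivity)
        (sum_le_hasSum _ (fun _ _ => by positivity) hasSum_half_pow_succ)
    · simpa using hyB ((Finset.range K).map ⟨φ, hφ.injective⟩)
  have hzcoord : ∀ k i, i < q k → b.coord i (z k) = 0 := fun k i hi => by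
    simp only [hz, hP, map_sub, coord_proj, if_pos hi, if_pos (hi.trans (hq k.lt_succ_self)),
      sub_self]
  have hzcoord' : ∀ k i, q (k + 1) ≤ i → b.coord i (z k) = 0 := fun k i hi => by
    simp only [hz, hP, map_sub, coord_proj, if_neg hi.not_gt,
      if_neg ((hq k.lt_succ_self).le.trans hi).not_gt, sub_self]
  -- Since `k ≤ q k`, blocks with `k > i` do not reach coordinate `i`, so `i + 1` blocks suffice.
  set w : ℕ → ℝ := fun i => b.coord i (∑ k ∈ Finset.range (i + 1), z k) with hw
  have hwK : ∀ i K, i < K → w i = b.coord i (∑ k ∈ Finset.range K, z k) := fun i K hi => by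
    simp only [hw, map_sum]
    refine Finset.sum_subset (Finset.range_mono hi) fun k _ hk => hzcoord k i ?_
    rw [Finset.mem_range, not_lt] at hk
    exact lt_of_lt_of_le hk (hq.le_apply)
  have hwP : ∀ n, b.partialSum w n = P n (∑ k ∈ Finset.range n, z k) := fun n => by
    rw [hP, proj_apply, partialSum]
    exact Finset.sum_congr rfl fun i hi => by rw [hwK i n (Finset.mem_range.1 hi)]
  refine ⟨w, D * (c / 2 + B), fun n => ?_, ?_⟩
  · rw [hwP]
    exact (P n).le_of_opNorm_le_of_le (hD n) (hzsum n)
  rintro ⟨x, hx⟩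
  have hwz : ∀ k i, q k ≤ i → i < q (k + 1) → w i = b.coord i (z k) := fun k i hi hi' => by
    rw [hwK i (max (i + 1) (k + 1)) (by omega), map_sum]
    refine Finset.sum_eq_single_of_mem k (Finset.mem_range.2 (by omega)) fun j _ hj => ?_
    rcases lt_or_gt_of_ne hj with hj | hj
    · exact hzcoord' j i ((hq.monotone hj).trans hi)
    · exact hzcoord j i (hi'.trans_le (hq.monotone hj))
  have hPz : ∀ k, P (q (k + 1)) x - P (q k) x = z k := fun k => by
    have h1 : P (q (k + 1)) (z k) = z k := by
      simp only [hz, hP, map_sub, proj_comp, min_self,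
        min_eq_right (hq k.lt_succ_self).le]
    have h2 : P (q k) (z k) = 0 := by
      simp only [hz, hP, map_sub, proj_comp, min_self,
        min_eq_left (hq k.lt_succ_self).le, sub_self]
    have h3 : ∀ v, P (q (k + 1)) v - P (q k) v =
        ∑ i ∈ Finset.Ico (q k) (q (k + 1)), b.coord i v • b i := fun v => by
      simp only [hP, proj_apply, Finset.sum_Ico_eq_sub _ (hq k.lt_succ_self).le]
    calc _ = P (q (k + 1)) (z k) - P (q k) (z k) := by
          rw [h3, h3]
          refine Finset.sum_congr rfl fun i hi => ?_
          rw [Finset.mem_Ico] at hi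
          rw [hx, hwz k i hi.1 hi.2]
      _ = z k := by rw [h1, h2, sub_zero]
  -- Convergence of `P n x` forces its blocks `z k` to zero, against `hznorm`.
  have hlim : Tendsto (fun k => z k) atTop (𝓝 0) := by
    have h1 := (b.tendsto_proj x).comp hq.tendsto_atTop
    have h2 := (h1.comp (tendsto_add_atTop_nat 1)).sub h1
    rw [sub_self] at h2
    exact h2.congr hPz
  have h0 := ge_of_tendsto' hlim.norm hznorm
  rw [norm_zero] at h0
  linarith

end SchauderBasis

theorem mainTheorem10 {X : Type*} [NormedAddCommGroup X] [NormedSpace ℝ X] [CompleteSpace X]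
    (b : SchauderBasis ℝ X) (hb : SchauderBasis.IsPremonotone b)
    (hX : ContainsCopyOfCZero X) : ¬ HasAffineFPP X := by
  obtain ⟨w, B, hB, hw⟩ := b.exists_bounded_partialSum_of_containsCopyOfCZero hX
  exact hb.not_hasAffineFPP_of_partialSum hB hw
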